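/- Let $P$ be a convex polygon in the plane. Let $x,y$ be points of $P$ that are not vertices and that lie on non-parallel sides. The segment $xy$ reflects to $yz$, where $z\neq x$ is the second point of $P$ on the line through $x$ parallel to the side containing $y$; the symplectic billiard map is $(x,y)\mapsto(y,z)$. An orbit is an infinite sequence $x_0,x_1,x_2,\dots$ such that, for every $k$, the points $x_k,x_{k+1}$ are not vertices and lie on non-parallel sides, and $x_kx_{k+1}$ reflects to $x_{k+1}x_{k+2}$. Let $ABCD$ be a trapezoid with parallel sides $AB$ and $CD$ and $|AB|>|CD|>0$. Its modulus is $n=\left[\frac{|AB|}{|AB|-|CD|}\right]$ (integer part), and the trapezoid is generic if $\frac{|AB|}{|AB|-|CD|}$ is not an integer. **Theorem.** Every symplectic billiard orbit in a trapezoid is periodic. If the trapezoid is generic of modulus $n$, then the periods are $16n-4$, $16n+4$ and $16n+12$, in the following sense: every orbit satisfies $x_{k+p}=x_k$ for all $k$ with some $p\in\{16n-4,\,16n+4,\,16n+12\}$; for all but finitely many orbits the least period is one of these three numbers; and for each $p\in\{16n-4,\,16n+4,\,16n+12\}$ there is a non-empty relatively open set of pairs $(x_0,x_1)$ in the phase space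 (the pairs of non-vertices on non-parallel sides), each of which starts an orbit of least period $p$. -/

import Mathlib

namespace SymplecticBilliard

/-- The Euclidean plane. -/
abbrev Plane : Type := EuclideanSpace ℝ (Fin 2)

section Polygon

variable {m : ℕ} [NeZero m]

/-- The direction vector of the `i`-th side of the polygon with vertices `v 0, …, v (m - 1)`
in cyclic order; indices are taken modulo `m`. -/
def sideDir (v : Fin m → Plane) (i : Fin m) : Plane := v (i + 1) - v i

/-- The `i`-th side without its end points. -/
def openSide (v : Fin m → Plane) (i : Fin m) : Set Plane := openSegment ℝ (v i) (v (i + 1))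

/-- The polygonal curve: the union of the closed sides. -/
def boundary (v : Fin m → Plane) : Set Plane := ⋃ i, segment ℝ (v i) (v (i + 1))

/-- The pairs `(x, y)` that are allowed as a segment of a billiard trajectory: `x` and `y` are not
vertices, and the sides containing them are not parallel (in particular they are different). -/
def phaseSpace (v : Fin m → Plane) : Set (Plane × Plane) :=
  {q | ∃ i j, q.1 ∈ openSide v i ∧ q.2 ∈ openSide v j ∧
    LinearIndependent ℝ ![sideDir v i, sideDir v j]}

/-- The reflection law: `x y` reflects to `y z` if `z` is the point of the polygon, other than `x`,
on the line through `x` parallel to the side containing `y`. -/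
def Reflects (v : Fin m → Plane) (x y z : Plane) : Prop :=
  z ∈ boundary v ∧ z ≠ x ∧ ∃ j, y ∈ openSide v j ∧ ∃ c : ℝ, z - x = c • sideDir v j

/-- A symplectic billiard orbit: an infinite sequence of points all of whose segments belong to the
phase space, and whose successive points obey the reflection law.
The billiard map is `(x k, x (k + 1)) ↦ (x (k + 1), x (k + 2))`. -/
def IsOrbit (v : Fin m → Plane) (x : ℕ → Plane) : Prop :=
  ∀ k, (x k, x (k + 1)) ∈ phaseSpace v ∧ Reflects v (x k) (x (k + 1)) (x (k + 2))

end Polygon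

/-- `p` is the least period of the sequence `x`. -/
def HasLeastPeriod (x : ℕ → Plane) (p : ℕ) : Prop :=
  IsLeast {r : ℕ | 0 < r ∧ Function.Periodic x r} p

/-- `A`, `B`, `C`, `D` are the consecutive vertices of a (nondegenerate, convex) trapezoid whose
parallel sides are `AB` and `CD`, the side `AB` being the longer one. -/
def IsTrapezoid (A B C D : Plane) : Prop :=
  AffineIndependent ℝ ![A, B, D] ∧ ∃ t : ℝ, 0 < t ∧ t < 1 ∧ C - D = t • (B - A)

/-- The number `|AB| / (|AB| - |CD|)`. -/
noncomputable def sideRatio (A B C D : Plane) : ℝ := dist A B / (dist A B - dist C D)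

/-- The modulus of a trapezoid: the integer part of `|AB| / (|AB| - |CD|)`. -/
noncomputable def modulus (A B C D : Plane) : ℕ := ⌊sideRatio A B C D⌋₊

/-- A trapezoid is generic if `|AB| / (|AB| - |CD|)` is not an integer. -/
def IsGeneric (A B C D : Plane) : Prop := ∀ k : ℤ, sideRatio A B C D ≠ k

end SymplecticBilliard

/-!
The billiard map commutes with affine maps, so the trapezoid may be taken to have the vertices
`(0, 0)`, `(L, 0)`, `(L - 1, 1)`, `(0, 1)` with `L = |AB| / (|AB| - |CD|)`. A step moves the first
point of a pair along the line parallel to the side of the second one. Hence a point moved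
alternately in the directions of the two legs advances along the bases by unit steps.

The dynamics is understood through the pairs with the first point on the left leg, at height `a`,
and the second one on the right leg, at height `b`. From such a pair on, the second point oscillates
between the legs at height `b`, and meanwhile the first one goes from the left leg along the bases
to the right leg. It arrives there at height `a' = L - m - a`, where `m` is the integer with
`0 < L - m - a < 1`, and at that moment the second point is on the left leg. This takes `4 * m + 3`
steps (`iterate_return`); in between no pair has one point on each leg (`iterate_before_return`).
If `L - a` is an integer, the first point runs into a vertex instead (`Live.exists_return`).
So the return map is `(a, b) ↦ (b, a')`. As `a ↦ a'` is an involution which preserves `m`, the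
fourth iterate of the return map is the identity, and the orbit has period `8 * (m + k) + 12`, where
`m` and `k` are the integers belonging to `a` and `b` (`isPeriodicPt_section`). A smaller period
would be the time of one of the first three returns, and this forces `a = a'` and `b = b'`
(`eq_of_isPeriodicPt_section`).

If `n` is the integer part of `L`, then `m` and `k` are `n` or `n - 1`, which yields the three
periods. There are only two heights with `a = a'`, so that only finitely many orbits have a
smaller period.

Every infinite orbit meets the two legs consecutively (`Live.meetsLegs`), either in the order (left,
right) or in the order (right, left); the affine symmetry of the trapezoid exchanging the legs
reduces the second case to the first. Since the reflection law is symmetric under time reversal, the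
map is injective, and periodicity propagates back to the start of the orbit.
-/

namespace SymplecticBilliard

/-! ### The normalised trapezoid and the billiard map in coordinates -/

/-- A point of the boundary of the normalised trapezoid with vertices `(0, 0)`, `(L, 0)`,
`(L - 1, 1)`, `(0, 1)`, tagged with its side. A point of a leg is given by its height, a point of a
base by its abscissa. -/
inductive BPoint : Type
  | left (h : ℝ)
  | right (h : ℝ)
  | bottom (s : ℝ)
  | top (s : ℝ)

/-- The direction of a side; the two bases are parallel and share theirs. -/
inductive Dir : Type
  | left
  | right
  | base

namespace BPoint

/-- The direction of the side containing a point. -/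
def dir : BPoint → Dir
  | left _ => .left
  | right _ => .right
  | bottom _ => .base
  | top _ => .base

/-- The parameter of the point lies strictly between those of the end points of its side. -/
def Inside (L : ℝ) : BPoint → Prop
  | left h => 0 < h ∧ h < 1
  | right h => 0 < h ∧ h < 1
  | bottom s => 0 < s ∧ s < L
  | top s => 0 < s ∧ s < L - 1

/-- The exchange of the two legs, an affine symmetry of the trapezoid. -/
def mirror (L : ℝ) : BPoint → BPoint
  | left h => right h
  | right h => left h
  | bottom s => bottom (L - s)
  | top s => top (L - 1 - s)

end BPoint

/-- The exchange of the two legs, on directions. -/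
def Dir.mirror : Dir → Dir
  | left => right
  | right => left
  | base => base

open BPoint

/-- The second point of the boundary on the line through a given point in a given direction.
The values are meaningful only if the point is not on a side of that direction and the line misses
the vertices; otherwise the result is the point itself or is not `Inside`. -/
noncomputable def move (L : ℝ) : Dir → BPoint → BPoint
  | .base, .left h => .right h
  | .base, .right h => .left h
  | .left, .right h => .bottom (L - h)
  | .left, .top s => .bottom s
  | .left, .bottom s => if s < L - 1 then .top s else .right (L - s)
  | .right, .left h => .bottom h
  | .right, .top s => .bottom (s + 1)
  | .right, .bottom s => if 1 < s then .top (s - 1) else .left s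
  | .base, .bottom s => .bottom s
  | .base, .top s => .top s
  | .left, .left h => .left h
  | .right, .right h => .right h

/-- The billiard map on pairs of consecutive points. -/
noncomputable def step (L : ℝ) (q : BPoint × BPoint) : BPoint × BPoint :=
  (q.2, move L q.2.dir q.1)

/-- The phase space: two points, not vertices, on sides of different directions. -/
def Admissible (L : ℝ) (q : BPoint × BPoint) : Prop :=
  q.1.Inside L ∧ q.2.Inside L ∧ q.1.dir ≠ q.2.dir

/-- A pair whose forward orbit never leaves the phase space. -/
def Live (L : ℝ) (q : BPoint × BPoint) : Prop := ∀ k, Admissible L ((step L)^[k] q)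

theorem Live.iterate {L : ℝ} {q : BPoint × BPoint} (h : Live L q) (k : ℕ) :
    Live L ((step L)^[k] q) := fun i => by
  rw [← Function.iterate_add_apply]
  exact h _

theorem move_move {L : ℝ} {d : Dir} {v : BPoint} (hv : v.Inside L) (hd : v.dir ≠ d) :
    move L d (move L d v) = v := by
  cases d <;> cases v <;> simp [dir] at hd <;> simp only [Inside] at hv
  all_goals grind [move]

/-- The billiard map is injective on the phase space, because the reflection law is symmetric
under reversal of time. -/
theorem step_injective {L : ℝ} {q q' : BPoint × BPoint} (hq : Admissible L q)
    (hq' : Admissible L q') (h : step L q = step L q') : q = q' := by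
  obtain ⟨v, w⟩ := q
  obtain ⟨v', w'⟩ := q'
  simp only [step, Prod.mk.injEq] at h
  obtain ⟨rfl, h⟩ := h
  have := congrArg (move L w.dir) h
  rw [move_move hq.1 hq.2.2, move_move hq'.1 hq'.2.2] at this
  exact Prod.ext this rfl

theorem Live.iterate_injective {L : ℝ} {q q' : BPoint × BPoint} (hq : Live L q) (hq' : Live L q')
    {k : ℕ} (h : (step L)^[k] q = (step L)^[k] q') : q = q' := by
  induction k with
  | zero => exact h
  | succ k ih =>
    rw [Function.iterate_succ_apply', Function.iterate_succ_apply'] at h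
    exact ih (step_injective (hq k) (hq' k) h)

/-- Periodicity of a later point of an orbit propagates back to its start. -/
theorem Live.isPeriodicPt_of_iterate {L : ℝ} {q : BPoint × BPoint} (hq : Live L q) {k p : ℕ}
    (h : Function.IsPeriodicPt (step L) p ((step L)^[k] q)) :
    Function.IsPeriodicPt (step L) p q := by
  have h' : (step L)^[p] ((step L)^[k] q) = (step L)^[k] q := h
  refine (hq.iterate p).iterate_injective hq (k := k) ?_
  rw [← Function.iterate_add_apply, add_comm, Function.iterate_add_apply, h']

/-! ### Mirror symmetry -/

/-- The exchange of the two legs, on pairs of points. -/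
def mirrorPair (L : ℝ) : BPoint × BPoint → BPoint × BPoint := Prod.map (mirror L) (mirror L)

theorem dir_mirror (L : ℝ) (v : BPoint) : (v.mirror L).dir = v.dir.mirror := by
  cases v <;> rfl

theorem mirror_mirror (L : ℝ) (v : BPoint) : (v.mirror L).mirror L = v := by
  cases v <;> simp [mirror]

theorem inside_mirror {L : ℝ} {v : BPoint} (hv : v.Inside L) : (v.mirror L).Inside L := by
  cases v <;> simp only [mirror, Inside] at hv ⊢ <;> grind

theorem move_mirror (L : ℝ) (d : Dir) (v : BPoint) :
    move L d.mirror (v.mirror L) = (move L d v).mirror L := by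
  cases d <;> cases v <;> simp only [Dir.mirror, mirror, move]
  all_goals grind [mirror]

theorem step_mirrorPair (L : ℝ) (q : BPoint × BPoint) :
    step L (mirrorPair L q) = mirrorPair L (step L q) := by
  simp [step, mirrorPair, dir_mirror, move_mirror]

theorem iterate_mirrorPair (L : ℝ) (k : ℕ) (q : BPoint × BPoint) :
    (step L)^[k] (mirrorPair L q) = mirrorPair L ((step L)^[k] q) :=
  (Function.Semiconj.iterate_right (f := mirrorPair L) (fun q => (step_mirrorPair L q).symm) k
    q).symm

theorem mirrorPair_mirrorPair (L : ℝ) (q : BPoint × BPoint) :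
    mirrorPair L (mirrorPair L q) = q :=
  Prod.ext (mirror_mirror L _) (mirror_mirror L _)

theorem live_mirrorPair {L : ℝ} {q : BPoint × BPoint} (h : Live L q) :
    Live L (mirrorPair L q) := fun k => by
  rw [iterate_mirrorPair]
  obtain ⟨h1, h2, h3⟩ := h k
  refine ⟨inside_mirror h1, inside_mirror h2, ?_⟩
  simp only [mirrorPair, Prod.map_fst, Prod.map_snd, dir_mirror]
  generalize ((step L)^[k] q).1.dir = d at *
  generalize ((step L)^[k] q).2.dir = e at *
  cases d <;> cases e <;> simp_all [Dir.mirror]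

theorem isPeriodicPt_mirrorPair {L : ℝ} {q : BPoint × BPoint} {p : ℕ}
    (h : Function.IsPeriodicPt (step L) p (mirrorPair L q)) :
    Function.IsPeriodicPt (step L) p q := by
  have h' : (step L)^[p] (mirrorPair L q) = mirrorPair L q := h
  rw [iterate_mirrorPair] at h'
  have := congrArg (mirrorPair L) h'
  rwa [mirrorPair_mirrorPair, mirrorPair_mirrorPair] at this

/-! ### The return map to the pairs (left leg, right leg) -/

theorem iterate_bottom_left {L s b : ℝ} (hs : s < L - 1) :
    (step L)^[4] (bottom s, left b) = (bottom (s + 1), left b) := by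
  simp [step, move, dir, hs]

/-- While the second point oscillates between the two legs, the first one moves along the bases:
it returns to the bottom one unit further after every four steps. -/
theorem iterate_section {L a : ℝ} (b : ℝ) (j : ℕ) (hj : a + j < L) :
    (step L)^[4 * j + 2] (left a, right b) = (bottom (a + j), left b) := by
  induction j with
  | zero => simp [step, move, dir]
  | succ j ih =>
    push_cast at hj ⊢
    rw [show 4 * (j + 1) + 2 = 4 + (4 * j + 2) by ring, Function.iterate_add_apply,
      ih (by linarith), iterate_bottom_left (by linarith), add_assoc]

/-- The return map: `4 * m + 3` steps after the pair with heights `a`, `b` comes the pair with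
heights `b`, `L - m - a`. -/
theorem iterate_return {L a : ℝ} (b : ℝ) {m : ℕ} (h1 : L - 1 < a + m) (h2 : a + m < L) :
    (step L)^[4 * m + 3] (left a, right b) = (left b, right (L - m - a)) := by
  rw [show 4 * m + 3 = (4 * m + 2) + 1 from rfl, Function.iterate_succ_apply',
    iterate_section b m h2]
  simp only [step, move, dir, not_lt.2 h1.le, if_false]
  congr 2
  ring

/-- All pairs met strictly before the return contain a point of a base. -/
theorem iterate_before_return {L a : ℝ} (ha : 0 < a) (b : ℝ) {m i : ℕ} (h2 : a + m < L)
    (hi0 : 0 < i) (hi : i < 4 * m + 3) :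
    (∃ s, 0 < s ∧ s < L ∧ ((step L)^[i] (left a, right b) = (right b, bottom s) ∨
      (step L)^[i] (left a, right b) = (bottom s, left b))) ∨
    (∃ s, 0 < s ∧ s < L - 1 ∧ ((step L)^[i] (left a, right b) = (left b, top s) ∨
      (step L)^[i] (left a, right b) = (top s, right b))) := by
  obtain rfl | hi1 : i = 1 ∨ 2 ≤ i := by omega
  · refine .inl ⟨a, ha, ?_, .inl ?_⟩
    · have : (0 : ℝ) ≤ m := m.cast_nonneg
      linarith
    · simp [step, move, dir]
  obtain ⟨j, r, hr, rfl⟩ : ∃ j r, r < 4 ∧ i = r + (4 * j + 2) :=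
    ⟨(i - 2) / 4, (i - 2) % 4, Nat.mod_lt _ (by norm_num), by omega⟩
  have hjm : (j : ℝ) ≤ m := by exact_mod_cast (by omega : j ≤ m)
  have hj0 : (0 : ℝ) ≤ j := j.cast_nonneg
  rw [Function.iterate_add_apply, iterate_section b j (by linarith)]
  obtain rfl | hr0 := Nat.eq_zero_or_pos r
  · exact .inl ⟨a + j, by linarith, by linarith, .inr rfl⟩
  have hjm' : (j : ℝ) + 1 ≤ m := by exact_mod_cast (by omega : j + 1 ≤ m)
  have hlt : a + j < L - 1 := by linarith
  interval_cases r
  · exact .inr ⟨a + j, by linarith, hlt, .inl (by simp [step, move, dir, hlt])⟩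
  · exact .inr ⟨a + j, by linarith, hlt, .inr (by simp [step, move, dir, hlt])⟩
  · exact .inl ⟨a + j + 1, by linarith, by linarith, .inl (by simp [step, move, dir, hlt])⟩

/-- The first point of a live pair never runs into the upper right vertex, so that the return map
is defined. -/
theorem Live.exists_return {L a b : ℝ} (h : Live L (left a, right b)) :
    ∃ m : ℕ, L - 1 < a + m ∧ a + m < L := by
  obtain ⟨⟨ha, ha1⟩, ⟨hb, hb1⟩, -⟩ := h 0
  have hb2 := (h 2).1
  have hL : a < L := by
    simp only [Function.iterate_succ, Function.comp_apply, step, dir, move, Function.iterate_zero,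
      id, Inside] at hb2
    exact hb2.2
  refine ⟨⌊L - a⌋₊, by linarith [Nat.lt_floor_add_one (L - a)],
    lt_of_le_of_ne (by linarith [Nat.floor_le (sub_nonneg.2 hL.le)]) fun he => ?_⟩
  generalize ⌊L - a⌋₊ = m at he
  obtain _ | m := m
  · simp only [Nat.cast_zero] at he
    linarith
  push_cast at he
  have h3 := (h (4 * m + 2 + 1)).2.1
  rw [Function.iterate_succ_apply', iterate_section b m (by linarith)] at h3
  have : ¬ a + m < L - 1 := by linarith
  simp only [step, dir, move, this, if_false, Inside] at h3
  linarith [h3.2]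

/-- Four returns bring a pair of heights `a`, `b` back:
`(a, b) ↦ (b, a') ↦ (a', b') ↦ (b', a) ↦ (a, b)`. -/
theorem isPeriodicPt_section {L a b : ℝ} {m k : ℕ} (ha : 0 < a ∧ a < 1) (hb : 0 < b ∧ b < 1)
    (h1 : L - 1 < a + m) (h2 : a + m < L) (h3 : L - 1 < b + k) (h4 : b + k < L) :
    Function.IsPeriodicPt (step L) (8 * (m + k) + 12) (left a, right b) := by
  have e1 := iterate_return b h1 h2
  have e2 := iterate_return (L - m - a) h3 h4
  have e3 := iterate_return (L := L) (a := L - m - a) (L - k - b) (m := m) (by linarith)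
    (by linarith)
  have e4 := iterate_return (L := L) (a := L - k - b) (L - m - (L - m - a)) (m := k) (by linarith)
    (by linarith)
  have : 8 * (m + k) + 12 = (4 * k + 3) + ((4 * m + 3) + ((4 * k + 3) + (4 * m + 3))) := by ring
  rw [Function.IsPeriodicPt, Function.IsFixedPt, this,
    Function.iterate_add_apply _ (4 * k + 3), Function.iterate_add_apply _ (4 * m + 3),
    Function.iterate_add_apply _ (4 * k + 3), e1, e2, e3, e4]
  congr 2 <;> ring

theorem le_of_iterate_eq_section {L a b a' b' : ℝ} (ha : 0 < a) {m i : ℕ} (h2 : a + m < L)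
    (hi0 : 0 < i) (h : (step L)^[i] (left a, right b) = (left a', right b')) : 4 * m + 3 ≤ i := by
  by_contra! hi
  rcases iterate_before_return ha b h2 hi0 hi with ⟨s, -, -, h' | h'⟩ | ⟨s, -, -, h' | h'⟩ <;>
    · rw [h'] at h
      simp at h

/-- The period found in `isPeriodicPt_section` is least unless both heights are fixed by the
involution `a ↦ L - m - a`: a smaller period would have to be the time of one of the first three
returns. -/
theorem eq_of_isPeriodicPt_section {L a b : ℝ} {m k p : ℕ} (ha : 0 < a ∧ a < 1)
    (hb : 0 < b ∧ b < 1) (h1 : L - 1 < a + m) (h2 : a + m < L) (h3 : L - 1 < b + k)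
    (h4 : b + k < L) (hp : 0 < p) (hp' : p < 8 * (m + k) + 12)
    (h : Function.IsPeriodicPt (step L) p (left a, right b)) :
    2 * a + m = L ∧ 2 * b + k = L := by
  have h : (step L)^[p] (left a, right b) = (left a, right b) := h
  have e1 := iterate_return b h1 h2
  have e2 := iterate_return (L - m - a) h3 h4
  have e3 := iterate_return (L := L) (a := L - m - a) (L - k - b) (m := m) (by linarith)
    (by linarith)
  obtain ⟨p, rfl⟩ := Nat.exists_eq_add_of_le' (le_of_iterate_eq_section ha.1 h2 hp h)
  rw [Function.iterate_add_apply, e1] at h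
  obtain rfl | hp := Nat.eq_zero_or_pos p
  · simp only [Function.iterate_zero, id, Prod.mk.injEq, left.injEq, right.injEq] at h
    obtain ⟨rfl, h⟩ := h
    -- `m = k`, as both are the integer with `L - 1 < b + m < L`
    have : m = k := by
      have i1 : (m : ℝ) < k + 1 := by linarith
      have i2 : (k : ℝ) < m + 1 := by linarith
      norm_cast at i1 i2
      omega
    subst this
    constructor <;> linarith
  obtain ⟨p, rfl⟩ := Nat.exists_eq_add_of_le' (le_of_iterate_eq_section hb.1 h4 hp h)
  rw [Function.iterate_add_apply, e2] at h
  obtain rfl | hp := Nat.eq_zero_or_pos p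
  · simp only [Function.iterate_zero, id, Prod.mk.injEq, left.injEq, right.injEq] at h
    constructor <;> linarith
  obtain ⟨p, rfl⟩ := Nat.exists_eq_add_of_le'
    (le_of_iterate_eq_section (m := m) (by linarith) (by linarith) hp h)
  rw [Function.iterate_add_apply, e3] at h
  obtain rfl | hp := Nat.eq_zero_or_pos p
  · simp only [Function.iterate_zero, id, Prod.mk.injEq, left.injEq, right.injEq] at h
    have : m = k := by
      have i1 : (m : ℝ) < k + 1 := by linarith
      have i2 : (k : ℝ) < m + 1 := by linarith
      norm_cast at i1 i2
      omega
    subst this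
    constructor <;> linarith
  have := le_of_iterate_eq_section (m := k) (by linarith) (by linarith) hp h
  omega

/-- Pairs of heights for which the return map is defined start infinite orbits. -/
theorem live_section {L a b : ℝ} {m k : ℕ} (ha : 0 < a ∧ a < 1)
    (hb : 0 < b ∧ b < 1) (h1 : L - 1 < a + m) (h2 : a + m < L) (h3 : L - 1 < b + k)
    (h4 : b + k < L) : Live L (left a, right b) := by
  intro i
  induction i using Nat.strong_induction_on generalizing a b m k with
  | _ i ih =>
    obtain rfl | hi0 := Nat.eq_zero_or_pos i
    · exact ⟨ha, hb, by simp [dir]⟩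
    by_cases hi : i < 4 * m + 3
    · rcases iterate_before_return ha.1 b h2 hi0 hi with
        ⟨s, hs, hs', h' | h'⟩ | ⟨s, hs, hs', h' | h'⟩ <;> rw [h'] <;>
      simp [Admissible, Inside, dir, *]
    · obtain ⟨j, rfl⟩ := Nat.exists_eq_add_of_le' (not_lt.1 hi)
      rw [Function.iterate_add_apply, iterate_return b h1 h2]
      exact ih j (by omega) (k := m) hb ⟨by linarith, by linarith⟩ h3 h4 (by linarith)
        (by linarith)

/-! ### Every orbit meets both legs consecutively -/

/-- Some pair of the orbit of `q` has one point on each leg. -/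
def MeetsLegs (L : ℝ) (q : BPoint × BPoint) : Prop :=
  ∃ k a b, (step L)^[k] q = (left a, right b) ∨ (step L)^[k] q = (right a, left b)

theorem MeetsLegs.of_iterate {L : ℝ} {q : BPoint × BPoint} (k : ℕ)
    (h : MeetsLegs L ((step L)^[k] q)) : MeetsLegs L q := by
  obtain ⟨i, a, b, h⟩ := h
  rw [← Function.iterate_add_apply] at h
  exact ⟨_, a, b, h⟩

theorem meetsLegs_mirrorPair {L : ℝ} {q : BPoint × BPoint} (h : MeetsLegs L (mirrorPair L q)) :
    MeetsLegs L q := by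
  obtain ⟨k, a, b, h⟩ := h
  rw [iterate_mirrorPair] at h
  refine ⟨k, a, b, ?_⟩
  rcases h with h | h <;> have h := congrArg (mirrorPair L) h <;>
    rw [mirrorPair_mirrorPair] at h
  · exact .inr h
  · exact .inl h

/-- Opposite a point of the left leg, a point of the bottom moves to the left until it reaches the
leg. -/
theorem meetsLegs_left_bottom {L a s : ℝ} : MeetsLegs L (left a, bottom s) := by
  obtain ⟨N, hN⟩ := exists_nat_ge s
  induction N generalizing s with
  | zero =>
    have : ¬ 1 < s := by
      push_cast at hN
      linarith
    exact ⟨2, a, s, .inr (by simp [step, move, dir, this])⟩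
  | succ N ih =>
    by_cases h1 : 1 < s
    · push_cast at hN
      refine .of_iterate 4 ?_
      have : (step L)^[4] (left a, bottom s) = (left a, bottom (s - 1)) := by
        simp [step, move, dir, h1]
      rw [this]
      exact ih (by linarith)
    · exact ⟨2, a, s, .inr (by simp [step, move, dir, h1])⟩

/-- Opposite a point of the left leg, a point of the top moves to the right until it reaches the
other leg. -/
theorem meetsLegs_left_top {L a s : ℝ} : MeetsLegs L (left a, top s) := by
  obtain ⟨N, hN⟩ := exists_nat_ge (L - s)
  induction N generalizing s with
  | zero =>
    have : ¬ s + 1 < L - 1 := by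
      push_cast at hN
      linarith
    exact ⟨4, a, L - (s + 1), .inl (by simp [step, move, dir, this])⟩
  | succ N ih =>
    by_cases h1 : s + 1 < L - 1
    · push_cast at hN
      refine .of_iterate 4 ?_
      have : (step L)^[4] (left a, top s) = (left a, top (s + 1)) := by
        simp [step, move, dir, h1]
      rw [this]
      exact ih (by linarith)
    · exact ⟨4, a, L - (s + 1), .inl (by simp [step, move, dir, h1])⟩

theorem meetsLegs_left {L a : ℝ} {w : BPoint} (hw : w.dir ≠ .left) : MeetsLegs L (left a, w) := by
  cases w with
  | left b => exact absurd rfl hw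
  | right b => exact ⟨0, a, b, .inl rfl⟩
  | bottom s => exact meetsLegs_left_bottom
  | top s => exact meetsLegs_left_top

theorem meetsLegs_right {L a : ℝ} {w : BPoint} (hw : w.dir ≠ .right) :
    MeetsLegs L (right a, w) := by
  refine meetsLegs_mirrorPair (meetsLegs_left ?_)
  rw [dir_mirror]
  cases w <;> simp_all [dir, Dir.mirror]

theorem Live.meetsLegs {L : ℝ} {q : BPoint × BPoint} (h : Live L q) : MeetsLegs L q := by
  obtain ⟨v, w⟩ := q
  have h0 := (h 0).2.2
  have h1 := (h 1).2.2
  simp only [Function.iterate_zero, id, Function.iterate_one, step] at h0 h1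
  cases v with
  | left a => exact meetsLegs_left h0.symm
  | right a => exact meetsLegs_right h0.symm
  | bottom s =>
    refine .of_iterate 1 ?_
    cases w with
    | left a => exact meetsLegs_left h1.symm
    | right a => exact meetsLegs_right h1.symm
    | bottom s => exact absurd rfl h0
    | top s => exact absurd rfl h0
  | top s =>
    refine .of_iterate 1 ?_
    cases w with
    | left a => exact meetsLegs_left h1.symm
    | right a => exact meetsLegs_right h1.symm
    | bottom s => exact absurd rfl h0
    | top s => exact absurd rfl h0

/-- Up to the mirror symmetry, every infinite orbit passes through a pair
(left leg, right leg). -/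
theorem Live.exists_section {L : ℝ} {q : BPoint × BPoint} (h : Live L q) :
    ∃ q', (q' = q ∨ q' = mirrorPair L q) ∧ ∃ k a b, (step L)^[k] q' = (left a, right b) := by
  obtain ⟨k, a, b, hk | hk⟩ := h.meetsLegs
  · exact ⟨q, .inl rfl, k, a, b, hk⟩
  · refine ⟨_, .inr rfl, k, a, b, ?_⟩
    rw [iterate_mirrorPair, hk]
    rfl

/-! ### Invariants of orbits of the normalised map -/

/-- Up to the mirror symmetry, every infinite orbit passes through a pair (left leg, right leg) on
which the return map and its square are defined. -/
theorem Live.exists_heights {L : ℝ} {q : BPoint × BPoint} (h : Live L q) :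
    ∃ q', (q' = q ∨ q' = mirrorPair L q) ∧ Live L q' ∧ ∃ i a b, ∃ m k : ℕ,
      (step L)^[i] q' = (left a, right b) ∧ (0 < a ∧ a < 1) ∧ (0 < b ∧ b < 1) ∧
      (L - 1 < a + m ∧ a + m < L) ∧ (L - 1 < b + k ∧ b + k < L) := by
  obtain ⟨q', hq', i, a, b, hi⟩ := h.exists_section
  have h' : Live L q' := by
    rcases hq' with rfl | rfl
    exacts [h, live_mirrorPair h]
  have hab := h'.iterate i
  rw [hi] at hab
  obtain ⟨ha, hb, -⟩ := hab 0
  obtain ⟨m, hm⟩ := hab.exists_return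
  have hret := hab.iterate (4 * m + 3)
  rw [iterate_return b hm.1 hm.2] at hret
  obtain ⟨k, hk⟩ := hret.exists_return
  exact ⟨q', hq', h', i, a, b, m, k, hi, ha, hb, hm, hk⟩

/-- The integer `m` with `L - 1 < a + m < L` is the integer part of `L` or one less. -/
theorem eq_or_eq_of_return {L a : ℝ} {m n : ℕ} (ha : 0 < a ∧ a < 1) (hn : n ≤ L)
    (hn' : L < n + 1) (h1 : L - 1 < a + m) (h2 : a + m < L) : m = n ∨ m + 1 = n := by
  have i1 : (m : ℝ) < n + 1 := by linarith
  have i2 : (n : ℝ) < m + 2 := by linarith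
  norm_cast at i1 i2
  omega

theorem period_mem {L a b : ℝ} {m k n : ℕ} (ha : 0 < a ∧ a < 1) (hb : 0 < b ∧ b < 1)
    (hn : n ≤ L) (hn' : L < n + 1) (hm : L - 1 < a + m ∧ a + m < L)
    (hk : L - 1 < b + k ∧ b + k < L) :
    8 * (m + k) + 12 ∈ ({16 * n - 4, 16 * n + 4, 16 * n + 12} : Set ℕ) := by
  have := eq_or_eq_of_return ha hn hn' hm.1 hm.2
  have := eq_or_eq_of_return hb hn hn' hk.1 hk.2
  simp only [Set.mem_insert_iff, Set.mem_singleton_iff]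
  omega

theorem Live.exists_isPeriodicPt {L : ℝ} {n : ℕ} {q : BPoint × BPoint} (h : Live L q)
    (hn : n ≤ L) (hn' : L < n + 1) :
    ∃ p ∈ ({16 * n - 4, 16 * n + 4, 16 * n + 12} : Set ℕ), 0 < p ∧
      Function.IsPeriodicPt (step L) p q := by
  obtain ⟨q', hq', h', i, a, b, m, k, hi, ha, hb, hm, hk⟩ := h.exists_heights
  refine ⟨_, period_mem ha hb hn hn' hm hk, by omega, ?_⟩
  have hp := isPeriodicPt_section ha hb hm.1 hm.2 hk.1 hk.2
  rw [← hi] at hp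
  have hp := h'.isPeriodicPt_of_iterate hp
  rcases hq' with rfl | rfl
  exacts [hp, isPeriodicPt_mirrorPair hp]

/-- The heights which may occur in orbits of smaller period: the fixed points of the involutions
`a ↦ L - m - a` for the two possible values of `m`. -/
def centralHeights (L : ℝ) (n : ℕ) : Set ℝ := {(L - n) / 2, (L - n + 1) / 2}

/-- Finitely many pairs which, together with their mirror images, contain the starting pairs of all
orbits whose least period is not one of the three generic ones. -/
def exceptionalPairs (L : ℝ) (n : ℕ) : Set (BPoint × BPoint) :=
  (fun t : ℕ × ℝ × ℝ => (step L)^[t.1] (left t.2.1, right t.2.2)) ''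
    (Set.Iic (16 * n + 12) ×ˢ (centralHeights L n ×ˢ centralHeights L n))

theorem finite_exceptionalPairs (L : ℝ) (n : ℕ) : (exceptionalPairs L n).Finite := by
  have : (centralHeights L n).Finite := by simp [centralHeights]
  exact ((Set.finite_Iic _).prod (this.prod this)).image _

theorem mem_exceptionalPairs {L a b : ℝ} {n p i : ℕ} {q : BPoint × BPoint}
    (ha : a ∈ centralHeights L n) (hb : b ∈ centralHeights L n) (hp : p ≤ 16 * n + 12)
    (hp0 : 0 < p) (hq : Function.IsPeriodicPt (step L) p q)
    (hi : (step L)^[i] q = (left a, right b)) : q ∈ exceptionalPairs L n := by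
  -- `q` comes back `p - i % p` steps after the given pair
  refine ⟨(p - i % p, a, b), ⟨?_, ha, hb⟩, ?_⟩
  · simp only [Set.mem_Iic]
    omega
  · have hlt := Nat.mod_lt i hp0
    rw [← hq.iterate_mod_apply] at hi
    change (step L)^[p - i % p] (left a, right b) = q
    rw [← hi, ← Function.iterate_add_apply, Nat.sub_add_cancel hlt.le]
    exact hq

/-- Apart from finitely many starting pairs, one of the three periods is least. -/
theorem Live.least_or_exceptional {L : ℝ} {n : ℕ} {q : BPoint × BPoint} (h : Live L q)
    (hn : n ≤ L) (hn' : L < n + 1) :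
    (∃ p ∈ ({16 * n - 4, 16 * n + 4, 16 * n + 12} : Set ℕ),
      IsLeast {r | 0 < r ∧ Function.IsPeriodicPt (step L) r q} p) ∨
    q ∈ exceptionalPairs L n ∪ mirrorPair L '' exceptionalPairs L n := by
  obtain ⟨q', hq', h', i, a, b, m, k, hi, ha, hb, hm, hk⟩ := h.exists_heights
  have hmem := period_mem ha hb hn hn' hm hk
  have hper : ∀ r, Function.IsPeriodicPt (step L) r q' ↔ Function.IsPeriodicPt (step L) r q := by
    intro r
    rcases hq' with rfl | rfl
    · rfl
    · refine ⟨isPeriodicPt_mirrorPair, fun hr => isPeriodicPt_mirrorPair ?_⟩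
      rwa [mirrorPair_mirrorPair]
  have hp := isPeriodicPt_section ha hb hm.1 hm.2 hk.1 hk.2
  rw [← hi] at hp
  have hp := h'.isPeriodicPt_of_iterate hp
  by_cases hleast : ∃ r, 0 < r ∧ r < 8 * (m + k) + 12 ∧ Function.IsPeriodicPt (step L) r q'
  · right
    obtain ⟨r, hr0, hr, hrp⟩ := hleast
    have hrp := hrp.apply_iterate i
    rw [hi] at hrp
    obtain ⟨h1, h2⟩ := eq_of_isPeriodicPt_section ha hb hm.1 hm.2 hk.1 hk.2 hr0 hr hrp
    have hcentral : ∀ {c : ℝ} {j : ℕ}, j = n ∨ j + 1 = n → 2 * c + j = L →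
        c ∈ centralHeights L n := by
      rintro c j (rfl | rfl) hc
      · left
        linarith
      · right
        push_cast
        simp only [Set.mem_singleton_iff]
        linarith
    have hq'mem : q' ∈ exceptionalPairs L n := by
      refine mem_exceptionalPairs (hcentral (eq_or_eq_of_return ha hn hn' hm.1 hm.2) h1)
        (hcentral (eq_or_eq_of_return hb hn hn' hk.1 hk.2) h2) ?_ (by omega) hp hi
      simp only [Set.mem_insert_iff, Set.mem_singleton_iff] at hmem
      omega
    rcases hq' with rfl | rfl
    · exact .inl hq'mem
    · exact .inr ⟨_, hq'mem, mirrorPair_mirrorPair L q⟩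
  · left
    push Not at hleast
    refine ⟨_, hmem, ⟨by omega, (hper _).1 hp⟩, fun r hr => ?_⟩
    by_contra! hlt
    exact hleast r hr.1 hlt ((hper _).2 hr.2)

/-! ### Trapezoids in affine coordinates -/

/-- The point with coordinates `p` in the affine frame with origin `O` and basis `e`, `f`. -/
noncomputable def place (O e f : Plane) (p : ℝ × ℝ) : Plane := O + (p.1 • e + p.2 • f)

/-- The image of the normalised trapezoid in an affine frame. -/
noncomputable def trapezoid (O e f : Plane) (L : ℝ) : Fin 4 → Plane :=
  ![O, O + L • e, O + ((L - 1) • e + f), O + f]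

/-- The coordinates of a boundary point of the normalised trapezoid. -/
def BPoint.coord (L : ℝ) : BPoint → ℝ × ℝ
  | left h => (0, h)
  | right h => (L - h, h)
  | bottom s => (s, 0)
  | top s => (s, 1)

/-- The index of the side of a boundary point. -/
def BPoint.side : BPoint → Fin 4
  | bottom _ => 0
  | right _ => 1
  | top _ => 2
  | left _ => 3

/-- The boundary point of a trapezoid which corresponds to one of the normalised trapezoid. -/
noncomputable def embed (O e f : Plane) (L : ℝ) (v : BPoint) : Plane := place O e f (v.coord L)

/-- An affine function whose level lines have the given direction. -/
def Dir.level : Dir → ℝ × ℝ → ℝ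
  | base, p => p.2
  | left, p => p.1
  | right, p => p.1 + p.2

variable {O e f : Plane} {L : ℝ}

theorem exists_coordinates (O : Plane) (hef : LinearIndependent ℝ ![e, f]) :
    ∃ c : Plane → ℝ × ℝ, Continuous c ∧ ∀ p, c (place O e f p) = p := by
  set b := basisOfLinearIndependentOfCardEqFinrank hef (by simp) with hb
  have b0 : b 0 = e := by simp [hb]
  have b1 : b 1 = f := by simp [hb]
  refine ⟨fun P => (b.coord 0 (P - O), b.coord 1 (P - O)), ?_, fun p => ?_⟩
  · exact ((b.coord 0).continuous_of_finiteDimensional.comp (by fun_prop)).prodMk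
      ((b.coord 1).continuous_of_finiteDimensional.comp (by fun_prop))
  · simp only [place, add_sub_cancel_left, map_add, map_smul, ← b0, ← b1]
    simp

theorem place_injective (O : Plane) (hef : LinearIndependent ℝ ![e, f]) :
    Function.Injective (place O e f) := by
  obtain ⟨c, -, hc⟩ := exists_coordinates O hef
  exact Function.LeftInverse.injective hc

theorem coord_injOn (hL : 1 < L) {v w : BPoint} (hv : v.Inside L) (hw : w.Inside L)
    (h : v.coord L = w.coord L) : v = w := by
  cases v <;> cases w <;> simp only [coord, Prod.mk.injEq, Inside] at h hv hw <;> grind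

theorem embed_injOn (hef : LinearIndependent ℝ ![e, f]) (hL : 1 < L) {v w : BPoint}
    (hv : v.Inside L) (hw : w.Inside L) (h : embed O e f L v = embed O e f L w) : v = w :=
  coord_injOn hL hv hw (place_injective O hef h)

theorem mem_openSide_iff (hL : 1 < L) {P : Plane} {i : Fin 4} :
    P ∈ openSide (trapezoid O e f L) i ↔
      ∃ v : BPoint, v.Inside L ∧ v.side = i ∧ embed O e f L v = P := by
  have hL0 : 0 < L := by linarith
  have hL1 : 0 < L - 1 := by linarith
  rw [openSide, openSegment_eq_image']
  constructor
  · rintro ⟨θ, ⟨h0, h1⟩, rfl⟩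
    fin_cases i
    · refine ⟨bottom (θ * L), ⟨by positivity, by nlinarith⟩, rfl, ?_⟩
      simp [trapezoid, embed, place, coord]
      module
    · refine ⟨right θ, ⟨h0, h1⟩, rfl, ?_⟩
      simp [trapezoid, embed, place, coord]
      module
    · refine ⟨top ((1 - θ) * (L - 1)), ⟨by nlinarith, by nlinarith⟩, rfl, ?_⟩
      simp [trapezoid, embed, place, coord]
      module
    · refine ⟨left (1 - θ), ⟨by linarith, by linarith⟩, rfl, ?_⟩
      simp [trapezoid, embed, place, coord]
      module
  · rintro ⟨v, hv, rfl, rfl⟩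
    cases v with
    | left h =>
      refine ⟨1 - h, ⟨by linarith [hv.2], by linarith [hv.1]⟩, ?_⟩
      simp [trapezoid, embed, place, coord, side]
      module
    | right h =>
      refine ⟨h, hv, ?_⟩
      simp [trapezoid, embed, place, coord, side]
      module
    | bottom s =>
      refine ⟨s / L, ⟨div_pos hv.1 hL0, (div_lt_one hL0).2 hv.2⟩, ?_⟩
      simp [trapezoid, embed, place, coord, side, smul_smul, hL0.ne']
    | top s =>
      refine ⟨1 - s / (L - 1), ⟨by linarith [(div_lt_one hL1).2 hv.2],
        by linarith [div_pos hv.1 hL1]⟩, ?_⟩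
      have : s • e = (s / (L - 1)) • (L - 1) • e := by
        rw [smul_smul, div_mul_cancel₀ _ hL1.ne']
      simp [trapezoid, embed, place, coord, side, this]
      module

/-- The coordinates of the sides as vectors. -/
def sideVec (L : ℝ) : Fin 4 → ℝ × ℝ := ![(L, 0), (-1, 1), (1 - L, 0), (0, -1)]

theorem sideDir_trapezoid (i : Fin 4) :
    sideDir (trapezoid O e f L) i = (sideVec L i).1 • e + (sideVec L i).2 • f := by
  fin_cases i <;> simp [sideDir, trapezoid, sideVec] <;> module

theorem linearIndependent_sideDir_iff (hef : LinearIndependent ℝ ![e, f]) (hL : 1 < L)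
    (v w : BPoint) :
    LinearIndependent ℝ ![sideDir (trapezoid O e f L) v.side, sideDir (trapezoid O e f L) w.side] ↔
      v.dir ≠ w.dir := by
  have hL0 : L ≠ 0 := by linarith
  have hL1 : 1 - L ≠ 0 := by linarith
  rw [sideDir_trapezoid, sideDir_trapezoid, LinearIndependent.pair_add_smul_add_smul_iff]
  cases v <;> cases w <;> simp [sideVec, side, dir, hef] <;> grind

theorem sub_eq_smul_sideDir_iff (hef : LinearIndependent ℝ ![e, f]) (hL : 1 < L)
    (p r : ℝ × ℝ) (w : BPoint) :
    (∃ c : ℝ, place O e f r - place O e f p = c • sideDir (trapezoid O e f L) w.side) ↔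
      w.dir.level p = w.dir.level r := by
  have hL0 : L ≠ 0 := by linarith
  have hL1 : 1 - L ≠ 0 := by linarith
  have key : ∀ c : ℝ, place O e f r - place O e f p =
      c • sideDir (trapezoid O e f L) w.side ↔
      r.1 - p.1 = c * (sideVec L w.side).1 ∧ r.2 - p.2 = c * (sideVec L w.side).2 := by
    intro c
    rw [sideDir_trapezoid]
    constructor
    · intro h
      have := @place_injective e f O hef r (p + c • sideVec L w.side) (by
        rw [sub_eq_iff_eq_add] at h
        rw [h]
        simp only [place, Prod.fst_add, Prod.snd_add, Prod.smul_fst, Prod.smul_snd, smul_eq_mul]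
        module)
      rw [this]
      simp
    · rintro ⟨h1, h2⟩
      rw [sub_eq_iff_eq_add'] at h1 h2
      simp only [place, h1, h2]
      module
  simp only [key]
  cases w with
  | left h =>
    simp only [sideVec, side, dir, Dir.level]
    refine ⟨fun ⟨c, h1, h2⟩ => ?_, fun h => ⟨p.2 - r.2, ?_⟩⟩ <;> simp at * <;> linarith
  | right h =>
    simp only [sideVec, side, dir, Dir.level]
    refine ⟨fun ⟨c, h1, h2⟩ => ?_, fun h => ⟨r.2 - p.2, ?_⟩⟩ <;> simp at * <;> linarith
  | bottom h =>
    simp only [sideVec, side, dir, Dir.level]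
    refine ⟨fun ⟨c, h1, h2⟩ => ?_, fun h => ⟨(r.1 - p.1) / L, ?_⟩⟩ <;> simp [hL0] at * <;> linarith
  | top h =>
    simp only [sideVec, side, dir, Dir.level]
    refine ⟨fun ⟨c, h1, h2⟩ => ?_, fun h => ⟨(r.1 - p.1) / (1 - L), ?_⟩⟩ <;> simp [hL1] at * <;>
      linarith

/-- The explicit formulas of `move` describe the intersection of the boundary with a line. -/
theorem eq_move_iff (hL : 1 < L) {d : Dir} {v z : BPoint} (hv : v.Inside L) (hz : z.Inside L)
    (hd : v.dir ≠ d) :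
    z = move L d v ↔ z ≠ v ∧ d.level (v.coord L) = d.level (z.coord L) := by
  cases d <;> cases v <;> simp [dir] at hd <;> cases z <;>
    simp only [Inside, move, Dir.level, coord] at * <;> grind

/-! ### Orbits in a trapezoid are orbits of the normalised map -/

theorem mem_phaseSpace_iff (hef : LinearIndependent ℝ ![e, f]) (hL : 1 < L) {P Q : Plane} :
    (P, Q) ∈ phaseSpace (trapezoid O e f L) ↔
      ∃ v w, Admissible L (v, w) ∧ embed O e f L v = P ∧ embed O e f L w = Q := by
  constructor
  · rintro ⟨i, j, hi, hj, hij⟩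
    obtain ⟨v, hv, rfl, rfl⟩ := (mem_openSide_iff hL).1 hi
    obtain ⟨w, hw, rfl, rfl⟩ := (mem_openSide_iff hL).1 hj
    exact ⟨v, w, ⟨hv, hw, (linearIndependent_sideDir_iff hef hL v w).1 hij⟩, rfl, rfl⟩
  · rintro ⟨v, w, ⟨hv, hw, hvw⟩, rfl, rfl⟩
    exact ⟨v.side, w.side, (mem_openSide_iff hL).2 ⟨v, hv, rfl, rfl⟩,
      (mem_openSide_iff hL).2 ⟨w, hw, rfl, rfl⟩, (linearIndependent_sideDir_iff hef hL v w).2 hvw⟩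

theorem reflects_iff (hef : LinearIndependent ℝ ![e, f]) (hL : 1 < L) {v w z : BPoint}
    (h : Admissible L (v, w)) (hz : z.Inside L) :
    Reflects (trapezoid O e f L) (embed O e f L v) (embed O e f L w) (embed O e f L z) ↔
      z = move L w.dir v := by
  obtain ⟨hv, hw, hvw⟩ := h
  rw [eq_move_iff hL hv hz hvw]
  constructor
  · rintro ⟨-, hne, j, hj, hc⟩
    obtain ⟨w', hw', rfl, hww'⟩ := (mem_openSide_iff hL).1 hj
    obtain rfl := embed_injOn hef hL hw' hw hww'
    exact ⟨fun h => hne (by rw [h]), (sub_eq_smul_sideDir_iff hef hL _ _ _).1 hc⟩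
  · rintro ⟨hne, hl⟩
    exact ⟨Set.mem_iUnion.2 ⟨z.side, openSegment_subset_segment _ _ _
        ((mem_openSide_iff hL).2 ⟨z, hz, rfl, rfl⟩)⟩,
      fun h => hne (embed_injOn hef hL hz hv h), w.side, (mem_openSide_iff hL).2 ⟨w, hw, rfl, rfl⟩,
      (sub_eq_smul_sideDir_iff hef hL _ _ _).2 hl⟩

/-- The sequence of points of a trapezoid given by the orbit of a pair. -/
noncomputable def trace (O e f : Plane) (L : ℝ) (q : BPoint × BPoint) (k : ℕ) : Plane :=
  embed O e f L ((step L)^[k] q).1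

theorem fst_iterate_succ (q : BPoint × BPoint) (k : ℕ) :
    ((step L)^[k + 1] q).1 = ((step L)^[k] q).2 := by
  rw [Function.iterate_succ_apply']
  rfl

theorem snd_iterate_succ (q : BPoint × BPoint) (k : ℕ) :
    ((step L)^[k + 1] q).2 = move L ((step L)^[k] q).2.dir ((step L)^[k] q).1 := by
  rw [Function.iterate_succ_apply']
  rfl

theorem isOrbit_iff (hef : LinearIndependent ℝ ![e, f]) (hL : 1 < L) {x : ℕ → Plane} :
    IsOrbit (trapezoid O e f L) x ↔ ∃ q, Live L q ∧ x = trace O e f L q := by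
  constructor
  · intro hx
    choose v w hvw hv hw using fun k => (mem_phaseSpace_iff hef hL).1 (hx k).1
    have hwv : ∀ k, w k = v (k + 1) := fun k =>
      embed_injOn hef hL (hvw k).2.1 (hvw (k + 1)).1 ((hw k).trans (hv (k + 1)).symm)
    have hmove : ∀ k, w (k + 1) = move L (w k).dir (v k) := fun k => by
      refine (reflects_iff (O := O) hef hL (hvw k) (hvw (k + 1)).2.1).1 ?_
      rw [hv, hw, hw]
      exact (hx k).2
    have hiter : ∀ k, (step L)^[k] (v 0, w 0) = (v k, w k) := by
      intro k
      induction k with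
      | zero => rfl
      | succ k ih =>
        rw [Function.iterate_succ_apply', ih, hmove, ← hwv]
        rfl
    refine ⟨(v 0, w 0), fun k => ?_, funext fun k => ?_⟩
    · rw [hiter]
      exact hvw k
    · rw [trace, hiter]
      exact (hv k).symm
  · rintro ⟨q, hq, rfl⟩ k
    refine ⟨(mem_phaseSpace_iff hef hL).2 ⟨_, _, hq k, rfl, ?_⟩, ?_⟩
    · rw [trace, fst_iterate_succ]
    · simp only [trace, fst_iterate_succ]
      exact (reflects_iff hef hL (hq k) (hq (k + 1)).2.1).2 (snd_iterate_succ q k)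

theorem periodic_trace_iff (hef : LinearIndependent ℝ ![e, f]) (hL : 1 < L)
    {q : BPoint × BPoint} (hq : Live L q) {p : ℕ} :
    Function.Periodic (trace O e f L q) p ↔ Function.IsPeriodicPt (step L) p q := by
  constructor
  · intro h
    have h0 := h 0
    have h1 := h 1
    rw [zero_add] at h0
    rw [add_comm] at h1
    simp only [trace, fst_iterate_succ] at h0 h1
    exact Prod.ext (embed_injOn hef hL (hq p).1 (hq 0).1 h0)
      (embed_injOn hef hL (hq p).2.1 (hq 0).2.1 h1)
  · intro h k
    rw [trace, Function.iterate_add_apply, h.eq, trace]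

theorem hasLeastPeriod_trace_iff (hef : LinearIndependent ℝ ![e, f]) (hL : 1 < L)
    {q : BPoint × BPoint} (hq : Live L q) {p : ℕ} :
    HasLeastPeriod (trace O e f L q) p ↔
      IsLeast {r | 0 < r ∧ Function.IsPeriodicPt (step L) r q} p := by
  simp only [HasLeastPeriod, periodic_trace_iff hef hL hq]

/-! ### Open sets of orbits of each period -/

/-- Starting pairs on the left and the right leg, with heights in open intervals on which `m` and
`k` are the integers of the return map, and below the fixed points of the involutions
`a ↦ L - m - a` and `b ↦ L - k - b`. -/
theorem exists_open_hasLeastPeriod (O : Plane) (hef : LinearIndependent ℝ ![e, f]) (hL : 1 < L)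
    {m k : ℕ} (hm : (m : ℝ) < L) (hm' : L < m + 2) (hk : (k : ℝ) < L) (hk' : L < k + 2) :
    ∃ U : Set (Plane × Plane), IsOpen U ∧ (U ∩ phaseSpace (trapezoid O e f L)).Nonempty ∧
      ∀ q ∈ U ∩ phaseSpace (trapezoid O e f L), ∃ x : ℕ → Plane,
        IsOrbit (trapezoid O e f L) x ∧ (x 0, x 1) = q ∧
          HasLeastPeriod x (8 * (m + k) + 12) := by
  obtain ⟨c, hc, hcp⟩ := exists_coordinates O hef
  have hce : ∀ v : BPoint, c (embed O e f L v) = v.coord L := fun v => hcp _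
  let I : ℕ → Set ℝ := fun j => Set.Ioo (max 0 (L - 1 - j)) ((L - j) / 2)
  have hI : ∀ {j : ℕ} {a : ℝ}, (j : ℝ) < L → L < j + 2 → a ∈ I j →
      (0 < a ∧ a < 1) ∧ L - 1 < a + j ∧ a + j < L ∧ 2 * a + j < L := by
    rintro j a h1 h2 ⟨h3, h4⟩
    rw [max_lt_iff] at h3
    refine ⟨⟨h3.1, ?_⟩, ?_, ?_, ?_⟩ <;> linarith
  have hne : ∀ {j : ℕ}, (j : ℝ) < L → L < j + 2 → (I j).Nonempty := by
    intro j h1 h2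
    refine Set.nonempty_Ioo.2 (max_lt ?_ ?_) <;> linarith
  refine ⟨{q | ((c q.1).2 ∈ I m ∧ (c q.1).1 + (c q.1).2 < L) ∧
    (c q.2).2 ∈ I k ∧ 0 < (c q.2).1}, ?_, ?_, ?_⟩
  · have h1 : Continuous fun q : Plane × Plane => c q.1 := hc.comp continuous_fst
    have h2 : Continuous fun q : Plane × Plane => c q.2 := hc.comp continuous_snd
    exact ((isOpen_Ioo.preimage h1.snd).inter
      (isOpen_lt (h1.fst.add h1.snd) continuous_const)).inter
      ((isOpen_Ioo.preimage h2.snd).inter (isOpen_lt continuous_const h2.fst))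
  · obtain ⟨a, ha⟩ := hne hm hm'
    obtain ⟨b, hb⟩ := hne hk hk'
    have ha' := hI hm hm' ha
    have hb' := hI hk hk' hb
    refine ⟨(embed O e f L (left a), embed O e f L (right b)), ?_,
      (mem_phaseSpace_iff hef hL).2 ⟨left a, right b, ⟨ha'.1, hb'.1, by simp [dir]⟩, rfl, rfl⟩⟩
    simp only [Set.mem_ofPred_eq, hce, coord]
    exact ⟨⟨ha, by linarith [ha'.1.2]⟩, hb, by linarith [hb'.1.2]⟩
  · rintro ⟨P, Q⟩ ⟨⟨⟨hP, hP'⟩, hQ, hQ'⟩, hq⟩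
    obtain ⟨v, w, -, rfl, rfl⟩ := (mem_phaseSpace_iff hef hL).1 hq
    simp only [hce] at hP hP' hQ hQ'
    have hP1 := hI hm hm' hP
    have hQ1 := hI hk hk' hQ
    obtain ⟨a, rfl⟩ : ∃ a, v = left a := by
      cases v <;> simp only [coord] at * <;> first | exact ⟨_, rfl⟩ | (exfalso; linarith)
    obtain ⟨b, rfl⟩ : ∃ b, w = right b := by
      cases w <;> simp only [coord] at * <;> first | exact ⟨_, rfl⟩ | (exfalso; linarith)
    simp only [coord] at hP1 hQ1
    obtain ⟨ha, h1, h2, h2a⟩ := hP1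
    obtain ⟨hb, h3, h4, h4b⟩ := hQ1
    have hlive := live_section ha hb h1 h2 h3 h4
    refine ⟨_, (isOrbit_iff hef hL).2 ⟨_, hlive, rfl⟩, rfl,
      (hasLeastPeriod_trace_iff hef hL hlive).2
        ⟨⟨by omega, isPeriodicPt_section ha hb h1 h2 h3 h4⟩, fun r hr => ?_⟩⟩
    by_contra! hlt
    have := eq_of_isPeriodicPt_section ha hb h1 h2 h3 h4 hr.1 hlt hr.2
    linarith [this.1]

/-! ### Normalisation of a trapezoid -/

/-- Every trapezoid is an affine image of the normalised one with `L = |AB| / (|AB| - |CD|)`; the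
first basis vector is `AB` divided by `L`. -/
theorem IsTrapezoid.exists_normalisation {A B C D : Plane} (hT : IsTrapezoid A B C D) :
    ∃ e f : Plane, LinearIndependent ℝ ![e, f] ∧ 1 < sideRatio A B C D ∧
      ![A, B, C, D] = trapezoid A e f (sideRatio A B C D) := by
  obtain ⟨hind, t, ht0, ht1, hCD⟩ := hT
  have hlin : LinearIndependent ℝ ![B - A, D - A] := by
    rw [affineIndependent_iff_linearIndependent_vsub ℝ _ (0 : Fin 3)] at hind
    let g : Fin 2 → {i : Fin 3 // i ≠ 0} := ![⟨1, by decide⟩, ⟨2, by decide⟩]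
    have hg : Function.Injective g := by decide
    have hfam : (fun i : {i : Fin 3 // i ≠ 0} => ![A, B, D] i -ᵥ ![A, B, D] 0) ∘ g =
        ![B - A, D - A] := by
      funext i
      fin_cases i <;> simp [g]
    rw [← hfam]
    exact hind.comp g hg
  have hAB : 0 < dist A B := by
    rw [dist_pos]
    rintro rfl
    exact hlin.ne_zero 0 (by simp)
  have hdist : dist C D = t * dist A B := by
    rw [dist_eq_norm, hCD, norm_smul, Real.norm_of_nonneg ht0.le, dist_comm A B, dist_eq_norm]
  have h1t : 0 < 1 - t := by linarith
  have hL : sideRatio A B C D = 1 / (1 - t) := by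
    rw [sideRatio, hdist]
    field_simp
  refine ⟨(1 - t) • (B - A), D - A, ?_, ?_, ?_⟩
  · have := (LinearIndependent.pair_add_smul_add_smul_iff (x := B - A) (y := D - A)
      (1 - t) 0 0 1).2 ⟨hlin, by simpa using h1t.ne'⟩
    simpa using this
  · rw [hL, lt_div_iff₀ h1t]
    linarith
  · have e1 : (1 / (1 - t)) • (1 - t) • (B - A) = B - A := by
      rw [smul_smul, one_div_mul_cancel h1t.ne', one_smul]
    have e2 : (1 / (1 - t) - 1) • (1 - t) • (B - A) = C - D := by
      rw [hCD, smul_smul, sub_mul, one_div_mul_cancel h1t.ne']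
      congr 1
      ring
    rw [hL, trapezoid, e1, e2]
    congr 1
    ext i j
    fin_cases i <;> simp

end SymplecticBilliard

open SymplecticBilliard in
theorem theorem3p2 (A B C D : Plane) (hT : IsTrapezoid A B C D) :
    -- all orbits are periodic
    (∀ x : ℕ → Plane, IsOrbit ![A, B, C, D] x → ∃ p : ℕ, 0 < p ∧ Function.Periodic x p) ∧
    (IsGeneric A B C D → ∀ n : ℕ, n = modulus A B C D →
      -- every orbit closes up after one of the three numbers of steps
      (∀ x : ℕ → Plane, IsOrbit ![A, B, C, D] x →
        ∃ p ∈ ({16 * n - 4, 16 * n + 4, 16 * n + 12} : Set ℕ), Function.Periodic x p) ∧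
      -- with finitely many exceptions, this number is the least period
      {x : ℕ → Plane | IsOrbit ![A, B, C, D] x ∧
        ¬ ∃ p ∈ ({16 * n - 4, 16 * n + 4, 16 * n + 12} : Set ℕ), HasLeastPeriod x p}.Finite ∧
      -- each of the three occurs as the least period, on an open set of initial segments
      (∀ p ∈ ({16 * n - 4, 16 * n + 4, 16 * n + 12} : Set ℕ),
        ∃ U : Set (Plane × Plane), IsOpen U ∧ (U ∩ phaseSpace ![A, B, C, D]).Nonempty ∧
          ∀ q ∈ U ∩ phaseSpace ![A, B, C, D], ∃ x : ℕ → Plane,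
            IsOrbit ![A, B, C, D] x ∧ (x 0, x 1) = q ∧ HasLeastPeriod x p)) := by
  obtain ⟨e, f, hef, hL, htrap⟩ := hT.exists_normalisation
  rw [htrap]
  have hn : (modulus A B C D : ℝ) ≤ sideRatio A B C D := Nat.floor_le (by linarith)
  have hn' : sideRatio A B C D < modulus A B C D + 1 := Nat.lt_floor_add_one _
  have hn1 : 1 ≤ modulus A B C D := Nat.le_floor (by simpa using hL.le)
  refine ⟨fun x hx => ?_, ?_⟩
  · obtain ⟨q, hq, rfl⟩ := (isOrbit_iff hef hL).1 hx
    obtain ⟨p, -, hp0, hp⟩ := hq.exists_isPeriodicPt hn hn'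
    exact ⟨p, hp0, (periodic_trace_iff hef hL hq).2 hp⟩
  rintro hgen n rfl
  have hlt : (modulus A B C D : ℝ) < sideRatio A B C D :=
    lt_of_le_of_ne hn fun h => hgen (modulus A B C D) (by rw [← h]; simp)
  generalize modulus A B C D = n at *
  generalize sideRatio A B C D = L at *
  refine ⟨fun x hx => ?_, ?_, fun p hp => ?_⟩
  · obtain ⟨q, hq, rfl⟩ := (isOrbit_iff hef hL).1 hx
    obtain ⟨p, hmem, -, hp⟩ := hq.exists_isPeriodicPt hn hn'
    exact ⟨p, hmem, (periodic_trace_iff hef hL hq).2 hp⟩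
  · have hfin := finite_exceptionalPairs L n
    refine ((hfin.union (hfin.image (mirrorPair L))).image (trace A e f L)).subset ?_
    rintro x ⟨hx, hxp⟩
    obtain ⟨q, hq, rfl⟩ := (isOrbit_iff hef hL).1 hx
    simp only [hasLeastPeriod_trace_iff hef hL hq] at hxp
    exact ⟨q, (hq.least_or_exceptional hn hn').resolve_left hxp, rfl⟩
  · obtain ⟨m, rfl⟩ := Nat.exists_eq_add_of_le' hn1
    push_cast at hlt hn'
    -- the two possible values of the integer in the return map
    have h0 : (m : ℝ) < L ∧ L < m + 2 := ⟨by linarith, by linarith⟩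
    have h1 : ((m + 1 : ℕ) : ℝ) < L ∧ L < (m + 1 : ℕ) + 2 := by
      push_cast
      exact ⟨by linarith, by linarith⟩
    obtain ⟨i, j, hi, hj, rfl⟩ : ∃ i j : ℕ, ((i : ℝ) < L ∧ L < i + 2) ∧
        ((j : ℝ) < L ∧ L < j + 2) ∧ p = 8 * (i + j) + 12 := by
      rcases hp with rfl | rfl | rfl
      · exact ⟨m, m, h0, h0, by omega⟩
      · exact ⟨m, m + 1, h0, h1, by omega⟩
      · exact ⟨m + 1, m + 1, h1, h1, by omega⟩
    exact exists_open_hasLeastPeriod A hef hL hi.1 hi.2 hj.1 hj.2
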